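/- Let $u,v,m\ge 0$ be integers. For a function $H:\{0,1\}^{u+1}\to\{0,1\}^v$ let $$|\psi_H\rangle := 2^{-(u+1)/2}\sum_{R\in\{0,1\}^{u+1}}|R\rangle|H(R)\rangle .$$ Let $\mathcal A$ be any (unbounded-time) quantum algorithm that takes as input a quantum state on $m$ copies of the $(u+1+v)$-qubit space and outputs a classical triple $(r,y_0,y_1)\in\{0,1\}^u\times\{0,1\}^v\times\{0,1\}^v$; that is, $\mathcal A$ is an arbitrary quantum measurement (POVM) with outcomes in this set. Then $$\Pr\bigl[\,y_0=H(0\|r)\ \wedge\ y_1=H(1\|r)\ :\ (r,y_0,y_1)\leftarrow\mathcal A(|\psi_H\rangle^{\otimes m})\,\bigr]\le (2m+1)^4\,(2^{-u}+2^{-v}),$$ where the probability is over a uniformly random function $H:\{0,1\}^{u+1}\to\{0,1\}^v$ and the measurement outcome of $\mathcal A$, and $\|$ denotes concatenation of bit strings. -/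

import Mathlib

open scoped ComplexOrder Matrix

/-- Bit strings of length `n`, i.e. `{0,1}^n`. -/
abbrev BitStr (n : ℕ) : Type := Fin n → Bool

/-- The concatenation `b ‖ r` of a bit `b` and a bit string `r`. -/
def prependBit {u : ℕ} (b : Bool) (r : BitStr u) : BitStr (u + 1) := Fin.cons b r

/-- Computational basis labels of one copy of the state: an input register and an output
register. The Hilbert space of one copy is `EuclideanSpace ℂ (CopyBasis u v)`. -/
abbrev CopyBasis (u v : ℕ) : Type := BitStr (u + 1) × BitStr v

/-- The normalized state `|ψ_H⟩ = 2^{-(u+1)/2} ∑_R |R⟩|H(R)⟩`. -/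
noncomputable def psi {u v : ℕ} (H : BitStr (u + 1) → BitStr v) :
    EuclideanSpace ℂ (CopyBasis u v) :=
  ((Real.sqrt ((2 : ℝ) ^ (u + 1)) : ℂ))⁻¹ •
    ∑ R : BitStr (u + 1), EuclideanSpace.single (R, H R) (1 : ℂ)

/-- The `m`-fold tensor power `|φ⟩^{⊗ m}` of a finite-dimensional state: its amplitude at the
basis vector `|x_0⟩ ⊗ ⋯ ⊗ |x_{m-1}⟩` is `∏ i, φ(x_i)`. -/
noncomputable def tensorPow {ι : Type} (m : ℕ) (φ : EuclideanSpace ℂ ι) :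
    EuclideanSpace ℂ (Fin m → ι) :=
  WithLp.toLp 2 fun x => ∏ i : Fin m, φ (x i)

/-- An unbounded-time quantum algorithm which takes as input a quantum state on the Hilbert space
with orthonormal basis `ι` and produces a classical output in `O`. There is no restriction on its
running time, so it is an arbitrary physically realizable measurement (POVM): a family of positive
semidefinite operators, one for each output, that sum to the identity. (Every procedure that
appends ancillas, applies unitaries or channels, measures, uses classical randomness and
post-processes classically is of this form.) -/
structure QuantumAlgorithm (ι O : Type) [Fintype ι] [DecidableEq ι] [Fintype O] where
  /-- The operator of each output. -/
  effect : O → Matrix ι ι ℂ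
  posSemidef : ∀ o, (effect o).PosSemidef
  sum_eq_one : ∑ o, effect o = 1

/-- Born rule: the probability `⟨φ| E_o |φ⟩` that the algorithm outputs `o` on input `|φ⟩`. -/
noncomputable def QuantumAlgorithm.outputProb {ι O : Type} [Fintype ι] [DecidableEq ι]
    [Fintype O] (A : QuantumAlgorithm ι O) (φ : EuclideanSpace ℂ ι) (o : O) : ℝ :=
  (star φ.ofLp ⬝ᵥ (A.effect o *ᵥ φ.ofLp)).re

/-- The output `(r, y₀, y₁)` is winning for `H`: `y₀ = H(0 ‖ r)` and `y₁ = H(1 ‖ r)`. -/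
def Wins {u v : ℕ} (H : BitStr (u + 1) → BitStr v) (z : BitStr u × BitStr v × BitStr v) : Prop :=
  z.2.1 = H (prependBit false z.1) ∧ z.2.2 = H (prependBit true z.1)

open scoped Classical in
/-- The probability, over a uniformly random `H : {0,1}^{u+1} → {0,1}^v` and over the measurement
outcome of the algorithm, that `A(|ψ_H⟩^{⊗ m})` outputs a winning `(r, y₀, y₁)`. -/
noncomputable def winProb {u v m : ℕ}
    (A : QuantumAlgorithm (Fin m → CopyBasis u v) (BitStr u × BitStr v × BitStr v)) : ℝ :=
  (∑ H : BitStr (u + 1) → BitStr v,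
      ∑ z : BitStr u × BitStr v × BitStr v with Wins H z,
        A.outputProb (tensorPow m (psi H)) z) /
    (Fintype.card (BitStr (u + 1) → BitStr v) : ℝ)

/-! The amplitude of `|ψ_H⟩^{⊗ m}` at a basis vector depends on `H` only at the inputs occurring in
it. For each `r`, split the state by whether `0 ‖ r` and `1 ‖ r` occur. Where one is missing, that
component is independent of the value there, so resampling the value gains a factor `2^{-v}`
(`card_mul_sum_apply_eq`). Both occur only if two copies have matching inputs, which has weight at
most `m² / 2^{u+1}` summed over `r` (`sum_norm_indicator_inter_queried_le`). The components are not
measured separately; `quadForm_add_le` controls their interference at the cost of constant factors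
(`quadForm_amp_le`). -/

open Finset

/-! ### Quadratic forms of positive operators and of measurements. -/

section QuadraticForm

variable {ι : Type} [Fintype ι]

/-- The (real) quadratic form `⟨x| E |x⟩` of a matrix `E`. -/
noncomputable def quadForm (E : Matrix ι ι ℂ) (x : ι → ℂ) : ℝ := (star x ⬝ᵥ (E *ᵥ x)).re

lemma quadForm_nonneg {E : Matrix ι ι ℂ} (hE : E.PosSemidef) (x : ι → ℂ) : 0 ≤ quadForm E x :=
  (Complex.nonneg_iff.mp (hE.dotProduct_mulVec_nonneg x)).1

/-- Parallelogram law: the cross terms cancel, so positivity is not needed. -/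
lemma quadForm_add_add_quadForm_sub (E : Matrix ι ι ℂ) (x y : ι → ℂ) :
    quadForm E (x + y) + quadForm E (x - y) = 2 * (quadForm E x + quadForm E y) := by
  simp only [quadForm, star_add, star_sub, Matrix.mulVec_add, Matrix.mulVec_sub, add_dotProduct,
    sub_dotProduct, dotProduct_add, dotProduct_sub, Complex.add_re, Complex.sub_re]
  ring

lemma quadForm_add_le {E : Matrix ι ι ℂ} (hE : E.PosSemidef) (x y : ι → ℂ) :
    quadForm E (x + y) ≤ 2 * (quadForm E x + quadForm E y) := by
  linarith [quadForm_add_add_quadForm_sub E x y, quadForm_nonneg hE (x - y)]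

lemma quadForm_sub_le {E : Matrix ι ι ℂ} (hE : E.PosSemidef) (x y : ι → ℂ) :
    quadForm E (x - y) ≤ 2 * (quadForm E x + quadForm E y) := by
  linarith [quadForm_add_add_quadForm_sub E x y, quadForm_nonneg hE (x + y)]

lemma quadForm_one [DecidableEq ι] (x : ι → ℂ) : quadForm 1 x = ∑ i, ‖x i‖ ^ 2 := by
  simp only [quadForm, Matrix.one_mulVec, dotProduct, Complex.re_sum, Pi.star_apply]
  refine sum_congr rfl fun i _ => ?_
  rw [Complex.star_def, ← Complex.normSq_eq_conj_mul_self, Complex.ofReal_re,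
    Complex.normSq_eq_norm_sq]

lemma quadForm_sum {O : Type} (s : Finset O) (E : O → Matrix ι ι ℂ) (x : ι → ℂ) :
    quadForm (∑ o ∈ s, E o) x = ∑ o ∈ s, quadForm (E o) x := by
  simp only [quadForm, Matrix.sum_mulVec, dotProduct_sum, Complex.re_sum]

lemma QuantumAlgorithm.sum_quadForm [DecidableEq ι] {O : Type} [Fintype O]
    (A : QuantumAlgorithm ι O) (x : ι → ℂ) :
    ∑ o, quadForm (A.effect o) x = ∑ i, ‖x i‖ ^ 2 := by
  rw [← quadForm_sum, A.sum_eq_one, quadForm_one]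

lemma QuantumAlgorithm.sum_quadForm_comp_le [DecidableEq ι] {O S : Type} [Fintype O] [Fintype S]
    (A : QuantumAlgorithm ι O) (x : ι → ℂ) {g : S → O} (hg : Function.Injective g) :
    ∑ s, quadForm (A.effect (g s)) x ≤ ∑ i, ‖x i‖ ^ 2 := by
  classical
  rw [← A.sum_quadForm x, ← sum_image (f := fun o => quadForm (A.effect o) x)
    (s := univ) (g := g) (fun a _ b _ h => hg h)]
  exact sum_le_sum_of_subset_of_nonneg (subset_univ _)
    fun o _ _ => quadForm_nonneg (A.posSemidef o) x

lemma QuantumAlgorithm.quadForm_le [DecidableEq ι] {O : Type} [Fintype O]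
    (A : QuantumAlgorithm ι O) (x : ι → ℂ) (o : O) :
    quadForm (A.effect o) x ≤ ∑ i, ‖x i‖ ^ 2 := by
  rw [← A.sum_quadForm x]
  exact single_le_sum (f := fun o => quadForm (A.effect o) x)
    (fun o _ => quadForm_nonneg (A.posSemidef o) x) (mem_univ o)

end QuadraticForm

/-! ### Counting: resampling a function value, and determined tuple entries. -/

section Resampling

/-- Resampling one value of a uniformly random function: if `G` ignores the value of its argument
at `p`, then that value is a uniformly random guess independent of `G`. -/
lemma card_mul_sum_apply_eq {X Y : Type} [Fintype X] [DecidableEq X] [Fintype Y]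
    (p : X) (G : (X → Y) → Y → ℝ)
    (hG : ∀ H y s, G (Function.update H p y) s = G H s) :
    (Fintype.card Y : ℝ) * ∑ H, G H (H p) = ∑ H, ∑ s, G H s := by
  classical
  -- Swapping the value at `p` with an independent sample `y` permutes the pairs `(H, y)`.
  have hinv : Function.Involutive
      fun a : (X → Y) × Y => (Function.update a.1 p a.2, a.1 p) := fun a => by simp
  have key := Equiv.sum_comp hinv.toPerm fun a : (X → Y) × Y => G a.1 a.2
  simp only [Function.Involutive.coe_toPerm, hG] at key
  rw [Fintype.sum_prod_type, Fintype.sum_prod_type] at key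
  rw [← key, mul_sum]
  simp

/-- Among tuples over `X`, at most a fraction `1 / |X|` has its `j`-th entry determined
by its `i`-th entry through `f`. -/
lemma card_mul_card_filter_apply_eq_le {X : Type} [Fintype X] [DecidableEq X] {m : ℕ}
    {i j : Fin m} (hij : i ≠ j) (f : X → X) :
    Fintype.card X * #{R : Fin m → X | R j = f (R i)} ≤ Fintype.card X ^ m := by
  have hcard : Fintype.card X ^ m = #(univ : Finset (Fin m → X)) := by simp
  rw [hcard, ← card_univ (α := X), ← card_product]
  -- Overwriting entry `j` loses nothing: it is recovered from entry `i ≠ j` through `f`.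
  refine card_le_card_of_injOn (fun a => Function.update a.2 j a.1) (fun _ _ => mem_univ _) ?_
  rintro ⟨x, R⟩ hR ⟨x', R'⟩ hR' h
  simp only [coe_product, Set.mem_prod, coe_filter, Set.mem_ofPred_eq, mem_univ, true_and] at hR hR'
  have hx : x = x' := by simpa using congrFun h j
  have hne : ∀ k, k ≠ j → R k = R' k := fun k hk => by simpa [hk] using congrFun h k
  have hRR : R = R' := by
    funext k
    by_cases hk : k = j
    · rw [hk, hR.2, hR'.2, hne i hij]
    · exact hne k hk
  rw [hx, hRR]

end Resampling

/-! ### Amplitudes of the state and the weight of its queried components. -/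

section States

variable {u v m : ℕ}

lemma psi_apply (H : BitStr (u + 1) → BitStr v) (R : BitStr (u + 1)) (s : BitStr v) :
    psi H (R, s) = if s = H R then ((Real.sqrt ((2 : ℝ) ^ (u + 1)) : ℂ))⁻¹ else 0 := by
  have : ∀ R' : BitStr (u + 1), ((R, s) = (R', H R')) ↔ (R' = R ∧ s = H R) := fun R' => by
    rw [Prod.mk.injEq]
    exact ⟨fun h => ⟨h.1.symm, h.1 ▸ h.2⟩, fun h => ⟨h.1.symm, h.1 ▸ h.2⟩⟩
  simp only [psi, PiLp.smul_apply, WithLp.ofLp_sum, Finset.sum_apply, PiLp.ofLp_single,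
    Pi.single_apply, this, ite_and, smul_eq_mul]
  simp

/-- The amplitudes of `|ψ_H⟩^{⊗ m}`. -/
noncomputable def amp (m : ℕ) (H : BitStr (u + 1) → BitStr v) : (Fin m → CopyBasis u v) → ℂ :=
  (tensorPow m (psi H)).ofLp

lemma norm_amp_sq (H : BitStr (u + 1) → BitStr v) (x : Fin m → CopyBasis u v) :
    ‖amp m H x‖ ^ 2 = if (fun i => (x i).2) = (fun i => H (x i).1)
      then (((2 : ℝ) ^ (u + 1)) ^ m)⁻¹ else 0 := by
  have h1 : ∀ y : CopyBasis u v,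
      ‖psi H y‖ ^ 2 = if y.2 = H y.1 then ((2 : ℝ) ^ (u + 1))⁻¹ else 0 := by
    rintro ⟨R, s⟩
    rw [psi_apply]
    split_ifs
    · rw [norm_inv, Complex.norm_real, Real.norm_eq_abs, inv_pow, sq_abs,
        Real.sq_sqrt (by positivity)]
    · simp
  simp only [amp, tensorPow, norm_prod, ← prod_pow, h1, funext_iff]
  rw [Fintype.prod_ite_zero]
  simp

/-- Measuring the input registers of `|ψ_H⟩^{⊗ m}` yields a uniformly random tuple. -/
lemma sum_norm_amp_sq_mul (H : BitStr (u + 1) → BitStr v) (w : (Fin m → BitStr (u + 1)) → ℝ) :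
    ∑ x, ‖amp m H x‖ ^ 2 * w (fun i => (x i).1) = (((2 : ℝ) ^ (u + 1)) ^ m)⁻¹ * ∑ R, w R := by
  rw [← Equiv.sum_comp (Equiv.arrowProdEquivProdArrow (Fin m) (fun _ => BitStr (u + 1))
    (fun _ => BitStr v)).symm, Fintype.sum_prod_type, mul_sum]
  refine sum_congr rfl fun R _ => ?_
  simp [norm_amp_sq, Equiv.arrowProdEquivProdArrow, ite_mul]

lemma sum_norm_amp_sq (H : BitStr (u + 1) → BitStr v) : ∑ x, ‖amp m H x‖ ^ 2 = 1 := by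
  have h := sum_norm_amp_sq_mul (m := m) H (fun _ => 1)
  simpa using h

/-- The basis vectors in which some copy has input `b ‖ r`. -/
def queried (m v : ℕ) (b : Bool) (r : BitStr u) : Set (Fin m → CopyBasis u v) :=
  {x | ∃ i, (x i).1 = prependBit b r}

lemma indicator_amp_update (H : BitStr (u + 1) → BitStr v) (b : Bool) (r : BitStr u)
    (y : BitStr v) {S : Set (Fin m → CopyBasis u v)} (hS : S ⊆ (queried m v b r)ᶜ) :
    S.indicator (amp m (Function.update H (prependBit b r) y)) = S.indicator (amp m H) := by
  refine Set.indicator_congr fun x hx => ?_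
  have hx' : ∀ i, (x i).1 ≠ prependBit b r := fun i hi => hS hx ⟨i, hi⟩
  simp only [amp, tensorPow]
  refine prod_congr rfl fun i _ => ?_
  rw [← Prod.mk.eta (p := x i), psi_apply, psi_apply, Function.update_of_ne (hx' i)]

lemma norm_indicator_sq {ι : Type} (S : Set ι) (f : ι → ℂ) (x : ι) :
    ‖S.indicator f x‖ ^ 2 = ‖f x‖ ^ 2 * S.indicator 1 x := by
  by_cases hx : x ∈ S <;> simp [hx]

/-- The `m` copies carry at most `m` inputs, and each determines a single `r`. -/
lemma sum_indicator_queried_le (b : Bool) (x : Fin m → CopyBasis u v) :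
    ∑ r, (queried m v b r).indicator (1 : (Fin m → CopyBasis u v) → ℝ) x ≤ m := by
  classical
  have h : ∀ r, (queried m v b r).indicator (1 : (Fin m → CopyBasis u v) → ℝ) x ≤
      ∑ i, if r = Fin.tail (x i).1 then 1 else 0 := fun r => by
    by_cases hx : x ∈ queried m v b r
    · obtain ⟨i, hi⟩ := hx
      rw [Set.indicator_of_mem (show x ∈ queried m v b r from ⟨i, hi⟩)]
      refine le_trans ?_ (single_le_sum (f := fun i => if r = Fin.tail (x i).1 then (1 : ℝ) else 0)
        (fun _ _ => by positivity) (mem_univ i))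
      simp [hi, prependBit]
    · rw [Set.indicator_of_notMem hx]
      positivity
  refine (sum_le_sum fun r _ => h r).trans ?_
  rw [sum_comm]
  simp

lemma sum_norm_indicator_queried_le (H : BitStr (u + 1) → BitStr v) (b : Bool) :
    ∑ r, ∑ x, ‖(queried m v b r).indicator (amp m H) x‖ ^ 2 ≤ m := by
  simp only [norm_indicator_sq]
  rw [sum_comm]
  calc _ ≤ ∑ x, ‖amp m H x‖ ^ 2 * (m : ℝ) := sum_le_sum fun x _ => by
        rw [← mul_sum]
        exact mul_le_mul_of_nonneg_left (sum_indicator_queried_le b x) (by positivity)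
    _ = m := by rw [← sum_mul, sum_norm_amp_sq, one_mul]

/-- The two inputs differ in their first bit, so they sit in distinct copies, and one determines the
other. This is a union bound over pairs of copies, in the form that
`card_mul_card_filter_apply_eq_le` counts. -/
lemma sum_indicator_inter_queried_le (x : Fin m → CopyBasis u v) :
    ∑ r, (queried m v false r ∩ queried m v true r).indicator (1 : (Fin m → CopyBasis u v) → ℝ) x ≤
      ∑ i, ∑ j, if i ≠ j ∧ (x j).1 = prependBit true (Fin.tail (x i).1) then 1 else 0 := by
  have h : ∀ r,
      (queried m v false r ∩ queried m v true r).indicator (1 : (Fin m → CopyBasis u v) → ℝ) x ≤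
      ∑ i, ∑ j, if (x i).1 = prependBit false r ∧ (x j).1 = prependBit true r
        then 1 else 0 := fun r => by
    by_cases hx : x ∈ queried m v false r ∩ queried m v true r
    · obtain ⟨⟨i, hi⟩, j, hj⟩ := id hx
      rw [Set.indicator_of_mem hx]
      refine le_trans ?_ (single_le_sum (fun _ _ => by positivity) (mem_univ i))
      refine le_trans ?_ (single_le_sum (fun _ _ => by positivity) (mem_univ j))
      simp [hi, hj]
    · rw [Set.indicator_of_notMem hx]
      positivity
  refine (sum_le_sum fun r _ => h r).trans ?_
  rw [sum_comm]
  refine sum_le_sum fun i _ => ?_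
  rw [sum_comm]
  refine sum_le_sum fun j _ => ?_
  refine le_trans (sum_le_sum (g := fun r => if r = Fin.tail (x i).1 then
    (if i ≠ j ∧ (x j).1 = prependBit true (Fin.tail (x i).1) then (1 : ℝ) else 0) else 0)
    fun r _ => ?_) (by simp)
  by_cases hr : (x i).1 = prependBit false r ∧ (x j).1 = prependBit true r
  · have hij : i ≠ j := by
      rintro rfl
      have := (Fin.cons_injective2 (hr.1.symm.trans hr.2)).1
      simp at this
    have ht : Fin.tail (x i).1 = r := by simp [hr.1, prependBit]
    rw [if_pos hr, if_pos ht.symm, if_pos ⟨hij, ht.symm ▸ hr.2⟩]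
  · rw [if_neg hr]
    positivity

lemma sum_norm_indicator_inter_queried_le (H : BitStr (u + 1) → BitStr v) :
    ∑ r, ∑ x, ‖(queried m v false r ∩ queried m v true r).indicator (amp m H) x‖ ^ 2 ≤
      (m : ℝ) ^ 2 / 2 ^ (u + 1) := by
  have hcount : ∀ i j : Fin m, ∑ R : Fin m → BitStr (u + 1),
      (if i ≠ j ∧ R j = prependBit true (Fin.tail (R i)) then (1 : ℝ) else 0) ≤
        ((2 : ℝ) ^ (u + 1)) ^ m / 2 ^ (u + 1) := fun i j => by
    by_cases hij : i = j
    · simp only [hij, ne_eq, not_true_eq_false, false_and, if_false, sum_const_zero]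
      positivity
    · rw [le_div_iff₀ (by positivity), mul_comm]
      have := card_mul_card_filter_apply_eq_le hij
        (fun R : BitStr (u + 1) => prependBit true (Fin.tail R))
      simp only [Fintype.card_fun, Fintype.card_bool, Fintype.card_fin] at this
      simp only [ne_eq, hij, not_false_eq_true, true_and, sum_boole]
      exact_mod_cast this
  simp only [norm_indicator_sq]
  rw [sum_comm]
  calc _ ≤ ∑ x : Fin m → CopyBasis u v, ‖amp m H x‖ ^ 2 * ∑ i, ∑ j,
          (if i ≠ j ∧ (x j).1 = prependBit true (Fin.tail (x i).1) then (1 : ℝ) else 0) :=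
        sum_le_sum fun x _ => by
          rw [← mul_sum]
          exact mul_le_mul_of_nonneg_left (sum_indicator_inter_queried_le x) (by positivity)
    _ = (((2 : ℝ) ^ (u + 1)) ^ m)⁻¹ * ∑ i, ∑ j, ∑ R : Fin m → BitStr (u + 1),
          (if i ≠ j ∧ R j = prependBit true (Fin.tail (R i)) then (1 : ℝ) else 0) := by
        rw [sum_norm_amp_sq_mul H fun R => ∑ i, ∑ j,
          (if i ≠ j ∧ R j = prependBit true (Fin.tail (R i)) then (1 : ℝ) else 0), sum_comm]
        congr 1
        exact sum_congr rfl fun i _ => sum_comm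
    _ ≤ (((2 : ℝ) ^ (u + 1)) ^ m)⁻¹ * ∑ _i : Fin m, ∑ _j : Fin m,
          ((2 : ℝ) ^ (u + 1)) ^ m / 2 ^ (u + 1) := by
        gcongr with i _ j _
        exact hcount i j
    _ = (m : ℝ) ^ 2 / 2 ^ (u + 1) := by
        simp only [sum_const, card_univ, Fintype.card_fin, nsmul_eq_mul]
        field_simp

end States

/-! ### Winning probability, component by component. -/

section Game

variable {u v m : ℕ}

/-- The winning output for `H` with first component `r`. -/
def winOutput (H : BitStr (u + 1) → BitStr v) (r : BitStr u) : BitStr u × BitStr v × BitStr v :=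
  (r, H (prependBit false r), H (prependBit true r))

lemma winProb_eq (A : QuantumAlgorithm (Fin m → CopyBasis u v) (BitStr u × BitStr v × BitStr v)) :
    winProb A = (∑ H : BitStr (u + 1) → BitStr v, ∑ r,
      quadForm (A.effect (winOutput H r)) (amp m H)) /
        (Fintype.card (BitStr (u + 1) → BitStr v) : ℝ) := by
  classical
  unfold winProb
  congr 1
  refine sum_congr rfl fun H _ => ?_
  rw [← sum_image (f := fun z => quadForm (A.effect z) (amp m H)) (s := univ)
    (g := winOutput H) (fun a _ b _ h => congrArg Prod.fst h)]
  refine sum_congr ?_ fun _ _ => rfl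
  ext ⟨r, y, y'⟩
  rw [mem_filter]
  simp only [mem_univ, true_and, mem_image, Wins, winOutput, Prod.mk.injEq]
  constructor
  · rintro ⟨h, h'⟩
    exact ⟨r, rfl, h.symm, h'.symm⟩
  · rintro ⟨_, rfl, h, h'⟩
    exact ⟨h.symm, h'.symm⟩

lemma prependBit_false_ne_true (r : BitStr u) : prependBit false r ≠ prependBit true r := fun h => by
  simpa using (Fin.cons_injective2 h).1

/-- On the component without the input `0 ‖ r`, the value `H (0 ‖ r)` can only be guessed. -/
lemma card_mul_sum_unqueried_eq
    (A : QuantumAlgorithm (Fin m → CopyBasis u v) (BitStr u × BitStr v × BitStr v))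
    (r : BitStr u) :
    (2 : ℝ) ^ v * ∑ H : BitStr (u + 1) → BitStr v,
      quadForm (A.effect (winOutput H r)) ((queried m v false r)ᶜ.indicator (amp m H)) =
    ∑ H : BitStr (u + 1) → BitStr v, ∑ s,
      quadForm (A.effect (r, s, H (prependBit true r)))
        ((queried m v false r)ᶜ.indicator (amp m H)) := by
  have h := card_mul_sum_apply_eq (prependBit false r) (fun H s =>
    quadForm (A.effect (r, s, H (prependBit true r)))
      ((queried m v false r)ᶜ.indicator (amp m H))) fun H y s => by
    rw [indicator_amp_update H false r y le_rfl,
      Function.update_of_ne (prependBit_false_ne_true r).symm]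
  simpa [winOutput] using h

/-- Giving up the guess of `H (1 ‖ r)` leaves effects no longer tied to `H`, so that summing over
`r` as well exhausts the measurement. -/
lemma sum_unqueried_le_sum
    (A : QuantumAlgorithm (Fin m → CopyBasis u v) (BitStr u × BitStr v × BitStr v))
    (r : BitStr u) :
    (2 : ℝ) ^ v * ∑ H : BitStr (u + 1) → BitStr v,
      quadForm (A.effect (winOutput H r)) ((queried m v false r)ᶜ.indicator (amp m H)) ≤
    ∑ H : BitStr (u + 1) → BitStr v, ∑ s, ∑ t,
      quadForm (A.effect (r, s, t)) ((queried m v false r)ᶜ.indicator (amp m H)) := by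
  rw [card_mul_sum_unqueried_eq]
  refine sum_le_sum fun H _ => sum_le_sum fun s _ => ?_
  exact single_le_sum (f := fun t => quadForm (A.effect (r, s, t)) _)
    (fun t _ => quadForm_nonneg (A.posSemidef _) _) (mem_univ _)

/-- On the component with the input `0 ‖ r` but without `1 ‖ r`, the value `H (1 ‖ r)` can only
be guessed. -/
lemma card_mul_sum_half_queried_le
    (A : QuantumAlgorithm (Fin m → CopyBasis u v) (BitStr u × BitStr v × BitStr v))
    (r : BitStr u) :
    (2 : ℝ) ^ v * ∑ H : BitStr (u + 1) → BitStr v,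
      quadForm (A.effect (winOutput H r))
        ((queried m v false r ∩ (queried m v true r)ᶜ).indicator (amp m H)) ≤
    ∑ H : BitStr (u + 1) → BitStr v, ∑ x, ‖(queried m v false r).indicator (amp m H) x‖ ^ 2 := by
  have h := card_mul_sum_apply_eq (prependBit true r) (fun H s =>
    quadForm (A.effect (r, H (prependBit false r), s))
      ((queried m v false r ∩ (queried m v true r)ᶜ).indicator (amp m H))) fun H y s => by
    rw [indicator_amp_update H true r y Set.inter_subset_right,
      Function.update_of_ne (prependBit_false_ne_true r)]
  have h' : (Fintype.card (BitStr v) : ℝ) = 2 ^ v := by simp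
  rw [h'] at h
  refine h.le.trans (sum_le_sum fun H _ => ?_)
  -- For fixed `H` and `r`, the outputs indexed by `s` are distinct, so their effects sum to at most
  -- the identity.
  refine (A.sum_quadForm_comp_le _ fun s t hst => by simpa using hst).trans ?_
  refine sum_le_sum fun x _ => ?_
  rw [norm_indicator_sq, norm_indicator_sq]
  exact mul_le_mul_of_nonneg_left (Set.indicator_le_indicator_of_subset Set.inter_subset_left
    (fun _ => zero_le_one' ℝ) x) (by positivity)

/-- The vector varies with `r`, so completeness of the measurement does not apply directly. Writing
it as the full state minus the queried part gives total weights `1` and at most `m`. -/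
lemma sum_sum_unqueried_le
    (A : QuantumAlgorithm (Fin m → CopyBasis u v) (BitStr u × BitStr v × BitStr v))
    (H : BitStr (u + 1) → BitStr v) :
    ∑ r, ∑ s, ∑ t, quadForm (A.effect (r, s, t)) ((queried m v false r)ᶜ.indicator (amp m H)) ≤
      2 * (1 + m) := by
  have h1 : ∑ r, ∑ s, ∑ t, quadForm (A.effect (r, s, t)) (amp m H) = 1 := by
    refine Eq.trans ?_ ((A.sum_quadForm (amp m H)).trans (sum_norm_amp_sq H))
    simp only [Fintype.sum_prod_type]
  have h2 : ∀ r, ∑ s, ∑ t, quadForm (A.effect (r, s, t)) ((queried m v false r).indicator (amp m H))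
      ≤ ∑ x, ‖(queried m v false r).indicator (amp m H) x‖ ^ 2 := fun r => by
    rw [← Fintype.sum_prod_type (f := fun p : BitStr v × BitStr v =>
      quadForm (A.effect (r, p)) ((queried m v false r).indicator (amp m H)))]
    exact A.sum_quadForm_comp_le _ fun p q hpq => (Prod.mk.inj hpq).2
  have h3 := (sum_le_sum fun r (_ : r ∈ univ) => h2 r).trans (sum_norm_indicator_queried_le H false)
  refine le_trans (sum_le_sum fun r _ => sum_le_sum fun s _ => sum_le_sum fun t _ => ?_)
    (b := ∑ r, ∑ s, ∑ t, 2 * (quadForm (A.effect (r, s, t)) (amp m H) +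
      quadForm (A.effect (r, s, t)) ((queried m v false r).indicator (amp m H)))) ?_
  · rw [Set.indicator_compl]
    exact quadForm_sub_le (A.posSemidef _) _ _
  · simp only [← mul_sum, sum_add_distrib]
    linarith

/-- Two successive binary splittings give the factors 2, 4, 4. -/
lemma quadForm_amp_le
    (A : QuantumAlgorithm (Fin m → CopyBasis u v) (BitStr u × BitStr v × BitStr v))
    (H : BitStr (u + 1) → BitStr v) (r : BitStr u)
    (z : BitStr u × BitStr v × BitStr v) :
    quadForm (A.effect z) (amp m H) ≤
      2 * quadForm (A.effect z) ((queried m v false r)ᶜ.indicator (amp m H)) +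
      4 * quadForm (A.effect z)
        ((queried m v false r ∩ (queried m v true r)ᶜ).indicator (amp m H)) +
      4 * ∑ x, ‖(queried m v false r ∩ queried m v true r).indicator (amp m H) x‖ ^ 2 := by
  classical
  have hsplit : amp m H = (queried m v false r)ᶜ.indicator (amp m H) +
      ((queried m v false r ∩ (queried m v true r)ᶜ).indicator (amp m H) +
        (queried m v false r ∩ queried m v true r).indicator (amp m H)) := by
    funext x
    by_cases h0 : x ∈ queried m v false r <;> by_cases h1 : x ∈ queried m v true r <;>
      simp [Set.indicator, h0, h1]
  have hE := A.posSemidef z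
  have h1 := quadForm_add_le hE ((queried m v false r)ᶜ.indicator (amp m H))
      ((queried m v false r ∩ (queried m v true r)ᶜ).indicator (amp m H) +
        (queried m v false r ∩ queried m v true r).indicator (amp m H))
  rw [← hsplit] at h1
  have h2 := quadForm_add_le hE
    ((queried m v false r ∩ (queried m v true r)ᶜ).indicator (amp m H))
    ((queried m v false r ∩ queried m v true r).indicator (amp m H))
  have h3 := A.quadForm_le ((queried m v false r ∩ queried m v true r).indicator (amp m H)) z
  linarith

/-- Without any copy of the state, both values can only be guessed. -/
lemma winProb_zero_le
    (A : QuantumAlgorithm (Fin 0 → CopyBasis u v) (BitStr u × BitStr v × BitStr v))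
    : winProb A ≤ 1 / (2 : ℝ) ^ v := by
  rw [winProb_eq, div_le_div_iff₀ (by positivity) (by positivity), one_mul, mul_comm]
  -- With no copies nothing is queried: the unqueried component is the whole state, and no constant
  -- is lost to splitting.
  have hu : ∀ (r : BitStr u) (H : BitStr (u + 1) → BitStr v),
      (queried 0 v false r)ᶜ.indicator (amp 0 H) = amp 0 H := fun r H =>
    Set.indicator_eq_self.mpr fun x _ ⟨i, _⟩ => i.elim0
  have h := sum_le_sum fun r (_ : r ∈ univ) => sum_unqueried_le_sum A r
  simp only [hu, ← mul_sum] at h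
  rw [sum_comm]
  refine h.trans ?_
  rw [sum_comm, ← nsmul_one, ← card_univ, ← sum_const]
  refine sum_le_sum fun H _ => ?_
  refine (Eq.trans ?_ ((A.sum_quadForm (amp 0 H)).trans (sum_norm_amp_sq H))).le
  simp only [Fintype.sum_prod_type]

lemma winProb_le (A : QuantumAlgorithm (Fin m → CopyBasis u v) (BitStr u × BitStr v × BitStr v)) :
    winProb A ≤ (4 + 8 * m) / (2 : ℝ) ^ v + 4 * ((m : ℝ) ^ 2 / 2 ^ (u + 1)) := by
  have hK : (0 : ℝ) < 2 ^ v := by positivity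
  set C : ℝ := (Fintype.card (BitStr (u + 1) → BitStr v) : ℝ) with hC
  have hsumC : ∀ c : ℝ, ∑ _H : BitStr (u + 1) → BitStr v, c = C * c := fun c => by
    rw [sum_const, nsmul_eq_mul, card_univ]
  have hα : (2 : ℝ) ^ v * ∑ H : BitStr (u + 1) → BitStr v, ∑ r,
      quadForm (A.effect (winOutput H r)) ((queried m v false r)ᶜ.indicator (amp m H)) ≤
        C * (2 * (1 + m)) := by
    rw [sum_comm, mul_sum, ← hsumC]
    refine (sum_le_sum fun r _ => sum_unqueried_le_sum A r).trans ?_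
    rw [sum_comm]
    exact sum_le_sum fun H _ => sum_sum_unqueried_le A H
  have hβ : (2 : ℝ) ^ v * ∑ H : BitStr (u + 1) → BitStr v, ∑ r,
      quadForm (A.effect (winOutput H r))
        ((queried m v false r ∩ (queried m v true r)ᶜ).indicator (amp m H)) ≤ C * m := by
    rw [sum_comm, mul_sum, ← hsumC]
    refine (sum_le_sum fun r _ => card_mul_sum_half_queried_le A r).trans ?_
    rw [sum_comm]
    exact sum_le_sum fun H _ => sum_norm_indicator_queried_le H false
  have hγ : ∑ H : BitStr (u + 1) → BitStr v, ∑ r, ∑ x,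
      ‖(queried m v false r ∩ queried m v true r).indicator (amp m H) x‖ ^ 2 ≤
        C * ((m : ℝ) ^ 2 / 2 ^ (u + 1)) := by
    rw [← hsumC]
    exact sum_le_sum fun H _ => sum_norm_indicator_inter_queried_le H
  rw [winProb_eq, div_le_iff₀ (by positivity)]
  refine (sum_le_sum fun H _ => sum_le_sum fun r _ =>
    quadForm_amp_le A H r (winOutput H r)).trans ?_
  simp only [sum_add_distrib, ← mul_sum]
  rw [← le_div_iff₀' hK] at hα hβ
  calc _ ≤ 2 * (C * (2 * (1 + m)) / 2 ^ v) + 4 * (C * m / 2 ^ v) +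
        4 * (C * ((m : ℝ) ^ 2 / 2 ^ (u + 1))) := by linarith
    _ = _ := by rw [← hC]; ring

end Game

theorem mainTheorem4 (u v m : ℕ)
    (A : QuantumAlgorithm (Fin m → CopyBasis u v) (BitStr u × BitStr v × BitStr v)) :
    winProb A ≤ (2 * (m : ℝ) + 1) ^ 4 * (1 / (2 : ℝ) ^ u + 1 / (2 : ℝ) ^ v) := by
  -- At `m = 0` the general bound gives `4 / 2^v`, while the target allows only the constant 1.
  rcases Nat.eq_zero_or_pos m with rfl | hm
  · have h := winProb_zero_le A
    have hu : (0 : ℝ) ≤ 1 / 2 ^ u := by positivity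
    simp only [Nat.cast_zero, mul_zero, zero_add, one_pow, one_mul]
    linarith
  · have hm' : (1 : ℝ) ≤ m := by exact_mod_cast hm
    have hK : 4 + 8 * (m : ℝ) ≤ (2 * (m : ℝ) + 1) ^ 4 := by
      -- Since `4 + 8m = 4(2m + 1)`, it is enough that `(2m + 1)³ ≥ 27 ≥ 4`.
      have : (3 : ℝ) ^ 3 ≤ (2 * (m : ℝ) + 1) ^ 3 := by gcongr; linarith
      nlinarith
    have hN : 2 * (m : ℝ) ^ 2 ≤ (2 * (m : ℝ) + 1) ^ 4 := by
      nlinarith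
    calc winProb A ≤ _ := winProb_le A
      _ = (4 + 8 * (m : ℝ)) * (1 / 2 ^ v) + 2 * (m : ℝ) ^ 2 * (1 / 2 ^ u) := by
        rw [pow_succ]; field_simp; ring
      _ ≤ (2 * (m : ℝ) + 1) ^ 4 * (1 / 2 ^ v) + (2 * (m : ℝ) + 1) ^ 4 * (1 / 2 ^ u) := by gcongr
      _ = _ := by ring
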